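/- Let $(R,\mathfrak m)$ be a Noetherian commutative local ring with $\operatorname{depth}(\mathfrak m)\ge 3$, where the depth of an ideal $I\subseteq\mathfrak m$ is the supremum of the lengths of the $R$-regular sequences contained in $I$. Let $n,l$ be natural numbers satisfying one of the following conditions: (a) $l\ge 3$ and $n\ge 2$; (b) $n=1$, $l$ is even and $l>0$. Then there exist an ideal $I$ of $R$ with $\operatorname{depth}(I)=3$ and a minimal acyclic complex $$0\to R^n\xrightarrow{d_3}R^{n+l}\xrightarrow{d_2}R^{l+1}\xrightarrow{d_1}R$$ resolving $R/I$; that is, the sequence $0\to R^n\to R^{n+l}\to R^{l+1}\to R\to R/I\to 0$ (with $R\to R/I$ the canonical projection) is exact, and all the entries of the matrices of $d_1,d_2,d_3$ lie in $\mathfrak m$. -/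

import Mathlib

/-- The depth (grade) of an ideal `I` of a commutative ring `R`, as an element of `ℕ∞`: the supremum
of the lengths of the `R`-regular sequences contained in `I`. For a proper ideal `I` the condition
`R ≠ (x₁, …, x_k)` in the definition of a regular sequence is automatic, so it is not imposed; with
this convention the unit ideal has depth `∞`, as usual. -/
noncomputable def idealDepth {R : Type*} [CommRing R] (I : Ideal R) : ℕ∞ :=
  ⨆ (xs : List R) (_ : (∀ x ∈ xs, x ∈ I) ∧ RingTheory.Sequence.IsWeaklyRegular R xs),
    (xs.length : ℕ∞)

/-- The sequence `0 → R^a → R^b → R^c → R`, with differentials `d₃`, `d₂`, `d₁`, is an acyclic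
complex (its only homology is in degree `0`) resolving the cyclic module `R ⧸ I`: the augmented
sequence `0 → R^a → R^b → R^c → R → R ⧸ I → 0` is exact. -/
structure IsFreeResolutionOfQuotient {R : Type*} [CommRing R] {a b c : ℕ}
    (d₃ : (Fin a → R) →ₗ[R] (Fin b → R)) (d₂ : (Fin b → R) →ₗ[R] (Fin c → R))
    (d₁ : (Fin c → R) →ₗ[R] R) (I : Ideal R) : Prop where
  injective : Function.Injective d₃
  exact₂ : Function.Exact d₃ d₂
  exact₁ : Function.Exact d₂ d₁
  exact₀ : Function.Exact d₁ (Submodule.mkQ I)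

/-- A linear map `d : F → G` of modules over a local ring `(R, 𝔪)` is minimal if `d(F) ⊆ 𝔪 G`;
for free modules of finite rank: all entries of its matrix lie in `𝔪`. A complex of free modules
is minimal if all its differentials are. -/
def IsMinimalMap {R : Type*} [CommRing R] [IsLocalRing R] {F G : Type*} [AddCommGroup F]
    [Module R F] [AddCommGroup G] [Module R G] (d : F →ₗ[R] G) : Prop :=
  LinearMap.range d ≤ IsLocalRing.maximalIdeal R • (⊤ : Submodule R G)

/-! Fix a regular sequence `x, y, z` in the maximal ideal and call `(n, l)` the format of a
resolution. Every ideal constructed lies in `(x, y, z)`, has a power of `x` and a power of `y` as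
its first two generators, and contains an element regular modulo `(x, y)`. This forces depth exactly
3: powers of `x` and `y` followed by that element are still a regular sequence, and Krull's height
theorem gives the upper bound. The same data let the constructions be iterated.

Growth: let `I` have format `(n, l)` and first generators `f, g`. Since `z` is regular modulo `(f,
yg)` and modulo `(xf, yg)`, the resolution of `I` can be glued to a Koszul complex, so that `(f, yg)
+ zI` has format `(n+1, l+1)` and `(xf, yg) + zI` has format `(n+1, l+2)` (`succ_succ`,
`succ_add_two`).

Gorenstein ideals: repeatedly bordering the Koszul matrix of `x, y, z` by two rows and columns gives
alternating matrices of every odd size whose Pfaffians generate a suitable ideal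
(`HasPfaffianComplex.odd`). This is the case `n = 1`, `l` even. Pfaffians are never expanded: the
vector `p` of Pfaffians is characterized as a generator of the kernel of the matrix.

Linkage: linking such an ideal with `m` generators through a regular sequence of length three gives
an almost complete intersection of format `(m, 3)`, or `(m-1, 3)` if the sequence contains one of
the given generators. As `m` runs over the odd numbers from 3 on, this covers `l = 3`, `n ≥ 2`.
Growth then reaches all remaining formats (`of_three_le`). -/

open RingTheory.Sequence

universe u

/-- Elementwise form of: `a, b, c` is a weakly regular sequence on `R`. -/
structure RegTriple {R : Type*} [CommRing R] (a b c : R) : Prop where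
  fst : ∀ r, a * r = 0 → r = 0
  snd : ∀ r s, b * r = a * s → ∃ t, r = a * t
  trd : ∀ r s t, c * r = a * s + b * t → ∃ s' t', r = a * s' + b * t'

/-! ### Regular sequences of length three and their Koszul complexes -/

namespace RegTriple

variable {R : Type*} [CommRing R] {a b c : R}

lemma isWeaklyRegular_iff : IsWeaklyRegular R [a, b, c] ↔ RegTriple a b c := by
  have key : ∀ (I : Ideal R) (r : R), IsSMulRegular (R ⧸ I • (⊤ : Ideal R)) r ↔
      ∀ s, r * s ∈ I → s ∈ I := by
    intro I r
    rw [isSMulRegular_iff_right_eq_zero_of_smul, (Submodule.mkQ_surjective _).forall]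
    refine forall_congr' fun s => ?_
    simp only [Submodule.mkQ_apply, ← Submodule.Quotient.mk_smul, Submodule.Quotient.mk_eq_zero]
    simp
  rw [isWeaklyRegular_iff_Fin]
  change (∀ i : Fin 3, _) ↔ _
  rw [Fin.forall_fin_succ, Fin.forall_fin_succ, Fin.forall_fin_succ]
  simp only [key]
  simp only [Fin.val_zero, List.take_zero, Ideal.ofList_nil, Ideal.mem_bot, Fin.val_succ,
    zero_add, Ideal.ofList_cons, List.take_succ_cons, Ideal.mem_span_singleton', sup_bot_eq,
    Submodule.mem_sup]
  change (∀ s, a * s = 0 → s = 0) ∧ (∀ s, (∃ t, t * a = b * s) → _) ∧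
    (∀ s, (∃ y, _ ∧ ∃ z, _ ∧ y + z = c * s) → _) ∧ _ ↔ _
  constructor
  · rintro ⟨h1, h2, h3, -⟩
    refine ⟨h1, fun r s h => ?_, fun r s t h => ?_⟩
    · obtain ⟨t, rfl⟩ := h2 r ⟨s, by rw [h, mul_comm]⟩
      exact ⟨t, mul_comm _ _⟩
    · obtain ⟨_, ⟨s', rfl⟩, _, ⟨t', rfl⟩, h'⟩ :=
        h3 r ⟨_, ⟨s, rfl⟩, _, ⟨t, rfl⟩, by rw [h, mul_comm a, mul_comm b]⟩
      exact ⟨s', t', by rw [← h', mul_comm a, mul_comm b]⟩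
  · rintro ⟨h1, h2, h3⟩
    refine ⟨h1, fun r => ?_, fun r => ?_, fun i => i.elim0⟩
    · rintro ⟨s, hs⟩
      obtain ⟨t, rfl⟩ := h2 r s (by rw [← hs, mul_comm])
      exact ⟨t, mul_comm _ _⟩
    · rintro ⟨_, ⟨s, rfl⟩, _, ⟨t, rfl⟩, h⟩
      obtain ⟨s', t', rfl⟩ := h3 r s t (by rw [← h, mul_comm a, mul_comm b])
      exact ⟨_, ⟨s', rfl⟩, _, ⟨t', rfl⟩, by rw [mul_comm a, mul_comm b]⟩

lemma mul_trd {d : R} (hc : RegTriple a b c) (hd : RegTriple a b d) : RegTriple a b (c * d) where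
  fst := hc.fst
  snd := hc.snd
  trd r s t h := by
    obtain ⟨s', t', h'⟩ := hc.trd (d * r) s t (by rw [← h]; ring)
    exact hd.trd _ _ _ h'

lemma add_trd (h : RegTriple a b c) (e : R) : RegTriple a b (c + a * b * e) where
  fst := h.fst
  snd := h.snd
  trd r s t hr := h.trd r (s - b * e * r) t (by linear_combination hr)

/-- `a` is regular modulo `b`. -/
lemma swap_snd (h : RegTriple a b c) (r s : R) (hr : a * r = b * s) : ∃ t, r = b * t := by
  obtain ⟨t, rfl⟩ := h.snd s r hr.symm
  exact ⟨t, sub_eq_zero.1 (h.fst _ (by linear_combination hr))⟩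

/-- Since `a` is also regular modulo `b`, one factor `a` at a time can be cancelled from a relation
modulo `b`. -/
lemma pow_fst (h : RegTriple a b c) (m : ℕ) : RegTriple (a ^ m) b c := by
  induction m with
  | zero =>
    exact ⟨fun r hr => by simpa using hr, fun r s _ => ⟨r, by simp⟩, fun r s t _ => ⟨r, 0, by simp⟩⟩
  | succ m ih =>
    refine ⟨fun r hr => h.fst _ (ih.fst _ (by rw [← hr]; ring)), fun r s hr => ?_,
      fun r s t hr => ?_⟩
    · obtain ⟨t, rfl⟩ := h.snd r (a ^ m * s) (by rw [hr]; ring)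
      obtain ⟨t', rfl⟩ := ih.snd t s
        (sub_eq_zero.1 (h.fst _ (by linear_combination hr)))
      exact ⟨t', by ring⟩
    · obtain ⟨s', t', rfl⟩ := h.trd r (a ^ m * s) t (by rw [hr]; ring)
      obtain ⟨v, hv⟩ := h.swap_snd (c * s' - a ^ m * s) (t - c * t')
        (by linear_combination hr)
      obtain ⟨p, q, rfl⟩ := ih.trd s' s v (by linear_combination hv)
      exact ⟨p, a * q + t', by ring⟩

lemma pow_snd (h : RegTriple a b c) (m : ℕ) : RegTriple a (b ^ m) c := by
  induction m with
  | zero =>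
    exact ⟨h.fst, fun r s hr => ⟨s, by simpa using hr⟩, fun r s t _ => ⟨0, r, by simp⟩⟩
  | succ m ih =>
    refine ⟨h.fst, fun r s hr => ?_, fun r s t hr => ?_⟩
    · obtain ⟨t, ht⟩ := h.snd (b ^ m * r) s (by rw [← hr]; ring)
      exact ih.snd r t ht
    · obtain ⟨s', t', rfl⟩ := h.trd r s (b ^ m * t) (by rw [hr]; ring)
      obtain ⟨v, hv⟩ := h.snd (c * t' - b ^ m * t) (s - c * s')
        (by linear_combination hr)
      obtain ⟨p, q, rfl⟩ := ih.trd t' v t (by linear_combination hv)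
      exact ⟨b * p + s', q, by ring⟩

lemma pow_pow (h : RegTriple a b c) (m n : ℕ) : RegTriple (a ^ m) (b ^ n) c :=
  (h.pow_fst m).pow_snd n

section Module

variable {M : Type*} [AddCommGroup M] [Module R M] [Module.Free R M]

lemma smul_eq_zero (h : RegTriple a b c) (v : M) (hv : a • v = 0) : v = 0 := by
  let B := Module.Free.chooseBasis R M
  refine B.repr.injective (Finsupp.ext fun i => ?_)
  rw [map_zero, Finsupp.zero_apply]
  exact h.fst _ (by simpa using DFunLike.congr_fun (congrArg B.repr hv) i)

variable [Module.Finite R M]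

lemma exists_smul_of_smul_eq (h : RegTriple a b c) (v w : M) (hv : b • v = a • w) :
    ∃ t, v = a • t := by
  let B := (Module.Free.chooseBasis R M).equivFun
  have key : ∀ i, ∃ t, B v i = a * t := fun i => h.snd _ (B w i) (by
    simpa only [map_smul, Pi.smul_apply, smul_eq_mul] using congrFun (congrArg B hv) i)
  choose t ht using key
  exact ⟨B.symm t, B.injective (by rw [map_smul, B.apply_symm_apply]; exact funext ht)⟩

lemma exists_smul_add_smul (h : RegTriple a b c) (v w w' : M) (hv : c • v = a • w + b • w') :
    ∃ s t, v = a • s + b • t := by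
  let B := (Module.Free.chooseBasis R M).equivFun
  have key : ∀ i, ∃ s t, B v i = a * s + b * t := fun i => h.trd _ (B w i) (B w' i) (by
    simpa only [map_smul, map_add, Pi.add_apply, Pi.smul_apply, smul_eq_mul] using congrFun (congrArg B hv) i)
  choose s t ht using key
  exact ⟨B.symm s, B.symm t, B.injective (by
    rw [map_add, map_smul, map_smul, B.apply_symm_apply, B.apply_symm_apply]; exact funext ht)⟩

/-- Exactness of the Koszul complex in degree one. -/
lemma koszul_one (h : RegTriple a b c) (u v w : M) (huv : a • u + b • v + c • w = 0) :
    ∃ p q r : M, u = b • r - c • q ∧ v = c • p - a • r ∧ w = a • q - b • p := by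
  obtain ⟨s, t, rfl⟩ := h.exists_smul_add_smul w (-u) (-v) (by
    rw [smul_neg, smul_neg, ← neg_add]; exact eq_neg_of_add_eq_zero_right huv)
  obtain ⟨r, hr⟩ := h.exists_smul_of_smul_eq (v + c • t) (-u - c • s) (by
    rw [← sub_eq_zero, ← huv]; module)
  refine ⟨-t, s, -r, ?_, ?_, by module⟩
  · rw [← sub_eq_zero]
    refine h.smul_eq_zero _ ?_
    calc _ = (a • u + b • v + c • (a • s + b • t)) - b • (v + c • t) + b • a • r := by module
      _ = 0 := by rw [huv, hr]; module
  · rw [eq_sub_iff_add_eq, ← sub_eq_zero, ← sub_eq_zero.2 hr]; module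

/-- Exactness of the Koszul complex in degree two. -/
lemma koszul_two (h : RegTriple a b c) (p q r : M) (h₂ : c • p = a • r)
    (h₃ : a • q = b • p) : ∃ t : M, p = a • t ∧ q = b • t ∧ r = c • t := by
  obtain ⟨t, rfl⟩ := h.exists_smul_of_smul_eq p q h₃.symm
  refine ⟨t, rfl, ?_, ?_⟩
  · rw [← sub_eq_zero]
    refine h.smul_eq_zero _ ?_
    rw [smul_sub, h₃]; module
  · rw [← sub_eq_zero]
    refine h.smul_eq_zero _ ?_
    rw [smul_sub, ← h₂]; module

end Module

end RegTriple

/-! ### Bounds for the depth of an ideal -/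

lemma le_idealDepth {R : Type*} [CommRing R] {I : Ideal R} {xs : List R} (hI : ∀ x ∈ xs, x ∈ I)
    (h : IsWeaklyRegular R xs) : (xs.length : ℕ∞) ≤ idealDepth I :=
  le_iSup₂_of_le (f := fun (xs : List R) (_ : (∀ x ∈ xs, x ∈ I) ∧ IsWeaklyRegular R xs) =>
    (xs.length : ℕ∞)) xs ⟨hI, h⟩ le_rfl

lemma exists_regTriple_of_le_idealDepth {R : Type*} [CommRing R] {I : Ideal R}
    (h : 3 ≤ idealDepth I) : ∃ a ∈ I, ∃ b ∈ I, ∃ c ∈ I, RegTriple a b c := by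
  by_contra! hne
  have : idealDepth I ≤ 2 := by
    refine iSup₂_le fun xs hxs => ?_
    match xs, hxs with
    | [], _ => simp
    | [_], _ => simp
    | [_, _], _ => simp
    | a :: b :: c :: l, ⟨hm, hr⟩ =>
      refine absurd (RegTriple.isWeaklyRegular_iff.1 ?_) (hne a (hm _ (by simp)) b (hm _ (by simp))
        c (hm _ (by simp)))
      rw [isWeaklyRegular_iff_Fin] at hr ⊢
      intro i
      have := hr ⟨i, by have := i.2; simp at this ⊢; omega⟩
      fin_cases i <;> exact this
  exact absurd (h.trans this) (by decide)

/-- The depth of a proper ideal of a Noetherian ring is at most the number of generators. -/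
lemma idealDepth_span_le {R : Type*} [CommRing R] [IsNoetherianRing R] {s : Set R} (hs : s.Finite)
    (h : Ideal.span s ≠ ⊤) : idealDepth (Ideal.span s) ≤ s.ncard := by
  -- At a minimal prime over the span, Krull's theorem bounds the height by the number of
  -- generators. In the localization there, a regular sequence of length `k` lowers the dimension by
  -- `k`, so `k` is at most this height.
  obtain ⟨p, hp⟩ := Ideal.nonempty_minimalPrimes h
  have := hp.1.1
  refine iSup₂_le fun xs ⟨hm, hr⟩ => ?_
  have h1 := Ideal.height_le_card_of_mem_minimalPrimes_span hs hp
  have hreg := hr.isRegular_of_isLocalization_of_mem (Localization.AtPrime p) p fun r hr' =>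
    hp.1.2 (hm r hr')
  have h2 := ringKrullDim_add_length_eq_ringKrullDim_of_isRegular _ hreg
  rw [IsLocalization.AtPrime.ringKrullDim_eq_height p (Localization.AtPrime p), List.length_map] at h2
  have h3 : Nontrivial (Localization.AtPrime p ⧸ Ideal.ofList
      (xs.map (algebraMap R (Localization.AtPrime p)))) := by
    refine Ideal.Quotient.nontrivial_iff.2 fun htop => ?_
    exact hreg.2 (by simpa using htop.symm)
  have h4 : (xs.length : WithBot ℕ∞) ≤ p.height := by
    rw [← h2]
    exact le_add_of_nonneg_left ringKrullDim_nonneg_of_nontrivial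
  exact (WithBot.coe_le_coe.1 (by exact_mod_cast h4)).trans h1

lemma idealDepth_mono {R : Type*} [CommRing R] {I J : Ideal R} (h : I ≤ J) :
    idealDepth I ≤ idealDepth J :=
  iSup₂_le fun _ hxs => le_idealDepth (fun x hx => h (hxs.1 x hx)) hxs.2

section SmulTop

variable {R M N : Type*} [CommRing R] [AddCommGroup M] [Module R M] [AddCommGroup N] [Module R N]
  {I : Ideal R}

lemma map_mem_smul_top (f : M →ₗ[R] N) {v : M} (hv : v ∈ I • (⊤ : Submodule R M)) :
    f v ∈ I • (⊤ : Submodule R N) :=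
  Submodule.smul_top_le_comap_smul_top I f hv

lemma mk_mem_smul_top_iff {v : M} {w : N} :
    (v, w) ∈ I • (⊤ : Submodule R (M × N)) ↔
      v ∈ I • (⊤ : Submodule R M) ∧ w ∈ I • (⊤ : Submodule R N) := by
  refine ⟨fun h => ⟨map_mem_smul_top (LinearMap.fst R M N) h,
    map_mem_smul_top (LinearMap.snd R M N) h⟩, fun h => ?_⟩
  have := add_mem (map_mem_smul_top (LinearMap.inl R M N) h.1)
    (map_mem_smul_top (LinearMap.inr R M N) h.2)
  simpa using this

lemma mem_smul_top_self_iff {r : R} : r ∈ I • (⊤ : Submodule R R) ↔ r ∈ I := by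
  simp

lemma smul_mem_smul_top {r : R} (hr : r ∈ I) (v : M) : r • v ∈ I • (⊤ : Submodule R M) :=
  Submodule.smul_mem_smul hr trivial

end SmulTop

/-! ### Adapted resolutions and the two growth steps -/

/-- A minimal free resolution `0 → F₃ → F₂ → R × R × U → R` of a cyclic module with entries in the
ideal generated by the sequence `x, y, z`, such that the first two generators of the ideal that is
resolved are powers of `x` and `y`, and such that this ideal contains an element that is regular
modulo `x, y`. -/
structure IsAdaptedResolution {R : Type*} [CommRing R] (x y z : R) {F₃ F₂ U : Type*}
    [AddCommGroup F₃] [Module R F₃] [AddCommGroup F₂] [Module R F₂] [AddCommGroup U] [Module R U]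
    (d₃ : F₃ →ₗ[R] F₂) (d₂ : F₂ →ₗ[R] R × R × U) (d₁ : R × R × U →ₗ[R] R) : Prop where
  injective : ∀ t, d₃ t = 0 → t = 0
  comp₂ : ∀ t, d₂ (d₃ t) = 0
  exact₂ : ∀ v, d₂ v = 0 → ∃ t, d₃ t = v
  comp₁ : ∀ v, d₁ (d₂ v) = 0
  exact₁ : ∀ w, d₁ w = 0 → ∃ v, d₂ v = w
  minimal₃ : ∀ t, d₃ t ∈ Ideal.span {x, y, z} • (⊤ : Submodule R F₂)
  minimal₂ : ∀ t, d₂ t ∈ Ideal.span {x, y, z} • (⊤ : Submodule R (R × R × U))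
  minimal₁ : ∀ t, d₁ t ∈ Ideal.span {x, y, z}
  pow_fst : ∃ m : ℕ, d₁ (1, 0, 0) = x ^ m
  pow_snd : ∃ m : ℕ, d₁ (0, 1, 0) = y ^ m
  regular : ∃ w, RegTriple x y (d₁ w)

/-- The existence of an adapted resolution of the format `(1, l + 1, n + l, n)`. -/
def HasAdaptedResolution {R : Type u} [CommRing R] (x y z : R) (n l : ℕ) : Prop :=
  ∃ (F₃ F₂ U : Type u) (_ : AddCommGroup F₃) (_ : Module R F₃) (_ : AddCommGroup F₂)
    (_ : Module R F₂) (_ : AddCommGroup U) (_ : Module R U) (_ : Module.Free R F₃)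
    (_ : Module.Finite R F₃) (_ : Module.Free R F₂) (_ : Module.Finite R F₂) (_ : Module.Free R U)
    (_ : Module.Finite R U) (d₃ : F₃ →ₗ[R] F₂) (d₂ : F₂ →ₗ[R] R × R × U) (d₁ : R × R × U →ₗ[R] R),
    Module.finrank R F₃ = n ∧ Module.finrank R F₂ = n + l ∧ Module.finrank R U + 1 = l ∧
    IsAdaptedResolution x y z d₃ d₂ d₁

namespace HasAdaptedResolution

variable {R : Type u} [CommRing R] {x y z : R} {n l : ℕ}

lemma x_mem : x ∈ Ideal.span {x, y, z} := Ideal.subset_span (by simp)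
lemma y_mem : y ∈ Ideal.span {x, y, z} := Ideal.subset_span (by simp)
lemma z_mem : z ∈ Ideal.span {x, y, z} := Ideal.subset_span (by simp)

lemma exists_isFreeResolutionOfQuotient [IsNoetherianRing R] [IsLocalRing R] (h : RegTriple x y z)
    (hx : x ∈ IsLocalRing.maximalIdeal R) (hy : y ∈ IsLocalRing.maximalIdeal R)
    (hz : z ∈ IsLocalRing.maximalIdeal R) (H : HasAdaptedResolution x y z n l) :
    ∃ (d₃ : (Fin n → R) →ₗ[R] (Fin (n + l) → R))
      (d₂ : (Fin (n + l) → R) →ₗ[R] (Fin (l + 1) → R))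
      (d₁ : (Fin (l + 1) → R) →ₗ[R] R) (I : Ideal R),
      IsFreeResolutionOfQuotient d₃ d₂ d₁ I ∧
      IsMinimalMap d₃ ∧ IsMinimalMap d₂ ∧ IsMinimalMap d₁ ∧
      idealDepth I = 3 := by
  obtain ⟨F₃, F₂, U, _, _, _, _, _, _, _, _, _, _, _, _, d₃, d₂, d₁, h₃, h₂, h₁, H⟩ := H
  have hle : Ideal.span {x, y, z} ≤ IsLocalRing.maximalIdeal R :=
    Ideal.span_le.2 (by rintro _ (rfl | rfl | rfl) <;> assumption)
  let e₃ : F₃ ≃ₗ[R] (Fin n → R) := LinearEquiv.ofFinrankEq _ _ (by simp [h₃])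
  let e₂ : F₂ ≃ₗ[R] (Fin (n + l) → R) := LinearEquiv.ofFinrankEq _ _ (by simp [h₂])
  let e₁ : (R × R × U) ≃ₗ[R] (Fin (l + 1) → R) := LinearEquiv.ofFinrankEq _ _
    (by simp [← h₁]; ring)
  refine ⟨e₂.toLinearMap ∘ₗ d₃ ∘ₗ e₃.symm.toLinearMap, e₁.toLinearMap ∘ₗ d₂ ∘ₗ e₂.symm.toLinearMap,
    d₁ ∘ₗ e₁.symm.toLinearMap, LinearMap.range d₁, ⟨?_, ?_, ?_, ?_⟩, ?_, ?_, ?_, ?_⟩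
  · rw [← LinearMap.ker_eq_bot, LinearMap.ker_eq_bot']
    intro t ht
    simpa using H.injective (e₃.symm t) (by simpa using ht)
  · intro v
    constructor
    · intro hv
      obtain ⟨t, ht⟩ := H.exact₂ (e₂.symm v) (by simpa using hv)
      exact ⟨e₃ t, by simp [ht]⟩
    · rintro ⟨t, rfl⟩
      simp [H.comp₂]
  · intro v
    constructor
    · intro hv
      obtain ⟨t, ht⟩ := H.exact₁ (e₁.symm v) (by simpa using hv)
      exact ⟨e₂ t, by simp [ht]⟩
    · rintro ⟨t, rfl⟩
      simp [H.comp₁]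
  · intro r
    rw [Submodule.mkQ_apply, Submodule.Quotient.mk_eq_zero]
    constructor
    · rintro ⟨w, rfl⟩
      exact ⟨e₁ w, by simp⟩
    · rintro ⟨w, rfl⟩
      exact ⟨_, rfl⟩
  · rintro _ ⟨t, rfl⟩
    exact Submodule.smul_mono_left hle (map_mem_smul_top e₂.toLinearMap (H.minimal₃ _))
  · rintro _ ⟨t, rfl⟩
    exact Submodule.smul_mono_left hle (map_mem_smul_top e₁.toLinearMap (H.minimal₂ _))
  · rintro _ ⟨t, rfl⟩
    exact mem_smul_top_self_iff.2 (hle (H.minimal₁ _))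
  · refine le_antisymm ?_ ?_
    · refine (idealDepth_mono (J := Ideal.span {x, y, z}) ?_).trans
        ((idealDepth_span_le (Set.toFinite _) ?_).trans ?_)
      · rintro _ ⟨w, rfl⟩
        exact H.minimal₁ w
      · exact fun htop => (IsLocalRing.maximalIdeal.isMaximal R).ne_top (top_le_iff.1 (htop ▸ hle))
      · have h1 := Set.ncard_insert_le x {y, z}
        have h2 := Set.ncard_insert_le y {z}
        rw [Set.ncard_singleton] at h2
        exact_mod_cast h1.trans (Nat.succ_le_succ h2)
    · obtain ⟨m, hm⟩ := H.pow_fst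
      obtain ⟨m', hm'⟩ := H.pow_snd
      obtain ⟨w, hw⟩ := H.regular
      refine le_idealDepth (xs := [x ^ m, y ^ m', d₁ w]) ?_
        (RegTriple.isWeaklyRegular_iff.2 (hw.pow_pow m m'))
      simp only [List.mem_cons, List.not_mem_nil, or_false]
      rintro _ (rfl | rfl | rfl)
      exacts [⟨_, hm⟩, ⟨_, hm'⟩, ⟨_, rfl⟩]

lemma map_eq_add {U : Type*} [AddCommGroup U] [Module R U] (d : R × R × U →ₗ[R] R) (w : R × R × U) :
    d w = w.1 * d (1, 0, 0) + w.2.1 * d (0, 1, 0) + d (0, 0, w.2.2) := by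
  rw [← smul_eq_mul, ← smul_eq_mul, ← map_smul, ← map_smul, ← map_add, ← map_add]
  simp

/-- With `I = (f, g, η(U))`, the new ideal is `(f, yg) + zI`; the generator `zf` is redundant, so
only one generator is added. -/
lemma succ_succ [Nontrivial R] (h : RegTriple x y z) (H : HasAdaptedResolution x y z n l) :
    HasAdaptedResolution x y z (n + 1) (l + 1) := by
  obtain ⟨F₃, F₂, U, _, _, _, _, _, _, _, _, _, _, _, _, d₃, d₂, d₁, h₃, h₂, h₁, H⟩ := H
  obtain ⟨m, hm⟩ := H.pow_fst
  obtain ⟨m', hm'⟩ := H.pow_snd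
  obtain ⟨w, hw⟩ := H.regular
  have hy : y ∈ Ideal.span {x, y, z} := y_mem
  have hz : z ∈ Ideal.span {x, y, z} := z_mem
  have hfm := H.minimal₁ (1, 0, 0)
  have hd₁ := map_eq_add d₁
  have hreg := h.pow_pow m (m' + 1)
  rw [pow_succ', ← hm, ← hm'] at hreg
  generalize d₁ (1, 0, 0) = f at *
  generalize d₁ (0, 1, 0) = g at *
  obtain ⟨η, hη⟩ : ∃ η : U →ₗ[R] R, ∀ u, d₁ (0, 0, u) = η u :=
    ⟨d₁ ∘ₗ LinearMap.inr R R (R × U) ∘ₗ LinearMap.inr R R U, fun u => rfl⟩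
  simp only [hη] at hd₁
  -- `σ` lifts the Koszul relation between `f` and `g`; it is the gluing datum in the last
  -- differential.
  obtain ⟨σ, hσ⟩ := H.exact₁ (-g, f, 0) (by rw [hd₁]; simp; ring)
  have hcomp := fun v => (hd₁ (d₂ v)).symm.trans (H.comp₁ v)
  let D₁ : R × R × R × U →ₗ[R] R :=
    { toFun := fun v => v.1 * f + v.2.1 * (y * g) + z * (v.2.2.1 * g + η v.2.2.2)
      map_add' := by
        intro v w
        simp; ring
      map_smul' := by
        intro c v
        simp; ring }
  let D₂ : F₂ × R × R →ₗ[R] R × R × R × U :=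
    { toFun := fun v => (z * (d₂ v.1).1 + y * g * v.2.2, z * v.2.1 - f * v.2.2,
        (d₂ v.1).2.1 - y * v.2.1, (d₂ v.1).2.2)
      map_add' := by
        intro v w
        ext <;> simp <;> ring
      map_smul' := by
        intro c v
        ext <;> simp <;> ring }
  let D₃ : F₃ × R →ₗ[R] F₂ × R × R :=
    { toFun := fun v => (d₃ v.1 + v.2 • y • σ, f * v.2, z * v.2)
      map_add' := by
        intro v w
        ext
        · simp only [Prod.fst_add, Prod.snd_add, map_add]; module
        all_goals (simp; ring)
      map_smul' := by
        intro c v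
        ext
        · simp only [Prod.smul_fst, Prod.smul_snd, map_smul, RingHom.id_apply, smul_eq_mul]; module
        all_goals (simp; ring) }
  refine ⟨F₃ × R, F₂ × R × R, R × U, inferInstance, inferInstance, inferInstance, inferInstance,
    inferInstance, inferInstance, inferInstance, inferInstance, inferInstance, inferInstance,
    inferInstance, inferInstance, D₃, D₂, D₁, by simp [h₃], by simp [h₂]; ring,
    by simp [← h₁]; ring, ?_⟩
  constructor
  · rintro ⟨t, s⟩ hts
    obtain ⟨h1, h2, h3⟩ : d₃ t + s • y • σ = 0 ∧ f * s = 0 ∧ z * s = 0 := by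
      simpa [D₃] using hts
    obtain rfl := hreg.fst _ h2
    simp [H.injective t (by simpa using h1)]
  · rintro ⟨t, s⟩
    simp [D₃, D₂, H.comp₂, hσ]
    refine ⟨?_, ?_, ?_⟩ <;> ring
  · rintro ⟨v, j, k⟩ hv
    obtain ⟨h1, h2, h3, h4⟩ : z * (d₂ v).1 + y * g * k = 0 ∧ z * j - f * k = 0 ∧
        (d₂ v).2.1 - y * j = 0 ∧ (d₂ v).2.2 = 0 := by
      simpa [D₂] using hv
    have hc := hcomp v
    rw [h4, map_zero] at hc
    obtain ⟨s, rfl, hs, rfl⟩ := hreg.koszul_two j (-(d₂ v).1) k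
      (by simp only [smul_eq_mul]; linear_combination h2)
      (by simp only [smul_eq_mul]; linear_combination -hc + g * h3)
    simp only [smul_eq_mul] at *
    obtain ⟨t, ht⟩ := H.exact₂ (v - s • y • σ) (by
      rw [map_sub, map_smul, map_smul, hσ]
      ext
      · simp; linear_combination -hs
      · simp; linear_combination h3
      · simpa using h4)
    exact ⟨(t, s), by simp [D₃, ht]⟩
  · rintro ⟨v, j, k⟩
    simp only [D₁, D₂, LinearMap.coe_mk, AddHom.coe_mk]
    linear_combination z * hcomp v
  · rintro ⟨a, b, c, u⟩ habw
    replace habw : a * f + b * (y * g) + z * (c * g + η u) = 0 := habw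
    -- Regularity of `z` modulo `(f, yg)` turns the relation into a syzygy of the old generators,
    -- which lifts to `v`; what is left is a Koszul relation between `f` and `yg`.
    obtain ⟨s, t, hst⟩ := hreg.trd (c * g + η u) (-a) (-b) (by linear_combination habw)
    obtain ⟨v, hv⟩ := H.exact₁ (-s, c - y * t, u) (by
      rw [hd₁]; linear_combination hst)
    obtain ⟨r, hr⟩ := hreg.snd (b + z * t) (-(a + z * s)) (by
      linear_combination habw - z * hst)
    have hr' : a + z * s = - (y * g) * r := by
      rw [← sub_eq_zero]
      refine hreg.fst _ ?_
      linear_combination habw - z * hst - (y * g) * hr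
    refine ⟨(v, -t, -r), ?_⟩
    simp only [D₂, LinearMap.coe_mk, AddHom.coe_mk, hv, Prod.mk.injEq, and_true]
    exact ⟨by linear_combination -hr', by linear_combination -hr, by ring⟩
  · rintro ⟨t, s⟩
    simp only [D₃, LinearMap.coe_mk, AddHom.coe_mk, mk_mem_smul_top_iff, mem_smul_top_self_iff]
    exact ⟨add_mem (H.minimal₃ t) (by rw [smul_comm]; exact smul_mem_smul_top hy _),
      Ideal.mul_mem_right _ _ hfm, Ideal.mul_mem_right _ _ hz⟩
  · rintro ⟨v, j, k⟩
    have hv := H.minimal₂ v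
    rw [← Prod.mk.eta (p := d₂ v), ← Prod.mk.eta (p := (d₂ v).2)] at hv
    simp only [D₂, LinearMap.coe_mk, AddHom.coe_mk, mk_mem_smul_top_iff,
      mem_smul_top_self_iff] at hv ⊢
    exact ⟨add_mem (Ideal.mul_mem_right _ _ hz) (by rw [mul_assoc]; exact Ideal.mul_mem_right _ _ hy),
      sub_mem (Ideal.mul_mem_right _ _ hz) (Ideal.mul_mem_right _ _ hfm),
      sub_mem hv.2.1 (Ideal.mul_mem_right _ _ hy), hv.2.2⟩
  · rintro ⟨a, b, c, u⟩
    exact add_mem (add_mem (Ideal.mul_mem_left _ _ hfm)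
      (Ideal.mul_mem_left _ _ (Ideal.mul_mem_right _ _ hy))) (Ideal.mul_mem_right _ _ hz)
  · exact ⟨m, by simp [D₁, hm]⟩
  · exact ⟨m' + 1, by simp [D₁, hm', pow_succ']⟩
  · refine ⟨(z * w.1, 0, w.2), ?_⟩
    convert h.mul_trd hw using 1
    simp only [D₁, LinearMap.coe_mk, AddHom.coe_mk, hd₁ w]
    ring

/-- The new ideal is `(xf, yg) + zI`; now `zf` and `zg` are both needed, so two generators are
added. The gluing is the same as in `succ_succ`. -/
lemma succ_add_two [Nontrivial R] (h : RegTriple x y z) (H : HasAdaptedResolution x y z n l) :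
    HasAdaptedResolution x y z (n + 1) (l + 2) := by
  obtain ⟨F₃, F₂, U, _, _, _, _, _, _, _, _, _, _, _, _, d₃, d₂, d₁, h₃, h₂, h₁, H⟩ := H
  obtain ⟨m, hm⟩ := H.pow_fst
  obtain ⟨m', hm'⟩ := H.pow_snd
  obtain ⟨w, hw⟩ := H.regular
  have hx : x ∈ Ideal.span {x, y, z} := x_mem
  have hy : y ∈ Ideal.span {x, y, z} := y_mem
  have hz : z ∈ Ideal.span {x, y, z} := z_mem
  have hd₁ := map_eq_add d₁
  have hreg := h.pow_pow (m + 1) (m' + 1)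
  rw [pow_succ', pow_succ', ← hm, ← hm'] at hreg
  generalize d₁ (1, 0, 0) = f at *
  generalize d₁ (0, 1, 0) = g at *
  obtain ⟨η, hη⟩ : ∃ η : U →ₗ[R] R, ∀ u, d₁ (0, 0, u) = η u :=
    ⟨d₁ ∘ₗ LinearMap.inr R R (R × U) ∘ₗ LinearMap.inr R R U, fun u => rfl⟩
  simp only [hη] at hd₁
  obtain ⟨σ, hσ⟩ := H.exact₁ (-g, f, 0) (by rw [hd₁]; simp; ring)
  let D₁ : R × R × R × R × U →ₗ[R] R :=
    { toFun := fun v => v.1 * (x * f) + v.2.1 * (y * g) + z * d₁ v.2.2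
      map_add' := by
        intro v w
        simp; ring
      map_smul' := by
        intro c v
        simp; ring }
  let D₂ : F₂ × R × R × R →ₗ[R] R × R × R × R × U :=
    { toFun := fun v => (z * v.2.1 + y * g * v.2.2.2, z * v.2.2.1 - x * f * v.2.2.2,
        (d₂ v.1).1 - x * v.2.1, (d₂ v.1).2.1 - y * v.2.2.1, (d₂ v.1).2.2)
      map_add' := by
        intro v w
        ext <;> simp <;> ring
      map_smul' := by
        intro c v
        ext <;> simp <;> ring }
  let D₃ : F₃ × R →ₗ[R] F₂ × R × R × R :=
    { toFun := fun v => (d₃ v.1 + v.2 • (x * y) • σ, - (y * g) * v.2, x * f * v.2, z * v.2)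
      map_add' := by
        intro v w
        ext
        · simp only [Prod.fst_add, Prod.snd_add, map_add]; module
        all_goals (simp; ring)
      map_smul' := by
        intro c v
        ext
        · simp only [Prod.smul_fst, Prod.smul_snd, map_smul, RingHom.id_apply, smul_eq_mul]; module
        all_goals (simp; ring) }
  refine ⟨F₃ × R, F₂ × R × R × R, R × R × U, inferInstance, inferInstance, inferInstance,
    inferInstance, inferInstance, inferInstance, inferInstance, inferInstance, inferInstance,
    inferInstance, inferInstance, inferInstance, D₃, D₂, D₁, by simp [h₃], by simp [h₂]; ring,
    by simp [← h₁]; ring, ?_⟩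
  constructor
  · rintro ⟨t, s⟩ hts
    obtain ⟨h1, h2, h3, h4⟩ : d₃ t + s • (x * y) • σ = 0 ∧ y * g * s = 0 ∧ x * f * s = 0 ∧
        z * s = 0 := by
      simpa [D₃] using hts
    obtain rfl := hreg.fst _ h3
    simp [H.injective t (by simpa using h1)]
  · rintro ⟨t, s⟩
    simp [D₃, D₂, H.comp₂, hσ]
    refine ⟨?_, ?_, ?_, ?_⟩ <;> ring
  · rintro ⟨v, i, j, k⟩ hv
    obtain ⟨h1, h2, h3, h4, h5⟩ : z * i + y * g * k = 0 ∧ z * j - x * f * k = 0 ∧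
        (d₂ v).1 - x * i = 0 ∧ (d₂ v).2.1 - y * j = 0 ∧ (d₂ v).2.2 = 0 := by
      simpa [D₂] using hv
    have hc := (hd₁ (d₂ v)).symm.trans (H.comp₁ v)
    rw [h5, map_zero] at hc
    obtain ⟨s, rfl, hs, rfl⟩ := hreg.koszul_two j (-i) k
      (by simp only [smul_eq_mul]; linear_combination h2)
      (by simp only [smul_eq_mul]; linear_combination -hc + f * h3 + g * h4)
    simp only [smul_eq_mul] at *
    obtain ⟨t, ht⟩ := H.exact₂ (v - s • (x * y) • σ) (by
      rw [map_sub, map_smul, map_smul, hσ]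
      ext
      · simp; linear_combination h3 - x * hs
      · simp; linear_combination h4
      · simpa using h5)
    exact ⟨(t, s), by simp [D₃, ht, ← hs]⟩
  · rintro ⟨v, i, j, k⟩
    have hc := (hd₁ (d₂ v)).symm.trans (H.comp₁ v)
    simp only [D₁, D₂, LinearMap.coe_mk, AddHom.coe_mk]
    rw [hd₁]
    linear_combination z * hc
  · rintro ⟨a, b, u⟩ habw
    replace habw : a * (x * f) + b * (y * g) + z * d₁ u = 0 := habw
    obtain ⟨s, t, hst⟩ := hreg.trd (d₁ u) (-a) (-b) (by linear_combination habw)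
    obtain ⟨v, hv⟩ := H.exact₁ (u.1 - x * s, u.2.1 - y * t, u.2.2) (by
      rw [hd₁] at hst ⊢; linear_combination hst)
    obtain ⟨r, hr⟩ := hreg.snd (b + z * t) (-(a + z * s)) (by
      linear_combination habw - z * hst)
    have hr' : a + z * s = - (y * g) * r := by
      rw [← sub_eq_zero]
      refine hreg.fst _ ?_
      linear_combination habw - z * hst - (y * g) * hr
    refine ⟨(v, -s, -t, -r), ?_⟩
    simp only [D₂, LinearMap.coe_mk, AddHom.coe_mk, hv]
    ext
    · simp; linear_combination -hr'
    · simp; linear_combination -hr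
    all_goals simp
  · rintro ⟨t, s⟩
    simp only [D₃, LinearMap.coe_mk, AddHom.coe_mk, mk_mem_smul_top_iff, mem_smul_top_self_iff]
    refine ⟨add_mem (H.minimal₃ t) ?_, ?_, ?_, Ideal.mul_mem_right _ _ hz⟩
    · rw [smul_comm]; exact smul_mem_smul_top (Ideal.mul_mem_right _ _ hx) _
    · exact Ideal.mul_mem_right _ _ (neg_mem (Ideal.mul_mem_right _ _ hy))
    · exact Ideal.mul_mem_right _ _ (Ideal.mul_mem_right _ _ hx)
  · rintro ⟨v, i, j, k⟩
    have hv := H.minimal₂ v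
    rw [← Prod.mk.eta (p := d₂ v), ← Prod.mk.eta (p := (d₂ v).2)] at hv
    simp only [D₂, LinearMap.coe_mk, AddHom.coe_mk, mk_mem_smul_top_iff,
      mem_smul_top_self_iff] at hv ⊢
    exact ⟨add_mem (Ideal.mul_mem_right _ _ hz) (Ideal.mul_mem_right _ _ (Ideal.mul_mem_right _ _ hy)),
      sub_mem (Ideal.mul_mem_right _ _ hz) (Ideal.mul_mem_right _ _ (Ideal.mul_mem_right _ _ hx)),
      sub_mem hv.1 (Ideal.mul_mem_right _ _ hx), sub_mem hv.2.1 (Ideal.mul_mem_right _ _ hy), hv.2.2⟩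
  · rintro ⟨a, b, u⟩
    exact add_mem (add_mem (Ideal.mul_mem_left _ _ (Ideal.mul_mem_right _ _ hx))
      (Ideal.mul_mem_left _ _ (Ideal.mul_mem_right _ _ hy))) (Ideal.mul_mem_right _ _ hz)
  · exact ⟨m + 1, by simp [D₁, hm, pow_succ']⟩
  · exact ⟨m' + 1, by simp [D₁, hm', pow_succ']⟩
  · refine ⟨(0, 0, w), ?_⟩
    convert h.mul_trd hw using 1
    simp [D₁]

end HasAdaptedResolution

/-! ### Pfaffian complexes of odd size -/

/-- A self-dual complex `0 → R → V → V → R` with `V = R × R × U`, whose middle map `A` is alternating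
with respect to a bilinear form and whose outer maps are given by a vector `p`, that resolves the
ideal generated by the values of the linear form `B p`. -/
structure IsPfaffianComplex {R : Type*} [CommRing R] (x y z : R) {U : Type*} [AddCommGroup U]
    [Module R U] (B : R × R × U →ₗ[R] R × R × U →ₗ[R] R) (A : R × R × U →ₗ[R] R × R × U)
    (p : R × R × U) : Prop where
  form_fst : ∀ t, B t (1, 0, 0) = t.1
  form_snd : ∀ t, B t (0, 1, 0) = t.2.1
  alternating : ∀ t, B t (A t) = 0
  map_eq_zero : A p = 0
  exists_smul : ∀ t, A t = 0 → ∃ c : R, t = c • p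
  exists_map : ∀ v, B p v = 0 → ∃ t, A t = v
  minimal_map : ∀ t, A t ∈ Ideal.span {x, y, z} • (⊤ : Submodule R (R × R × U))
  minimal_vec : p ∈ Ideal.span {x, y, z} • (⊤ : Submodule R (R × R × U))
  pow_fst : ∃ m : ℕ, p.1 = x ^ m
  pow_snd : ∃ m : ℕ, p.2.1 = y ^ m
  regular : ∃ w, RegTriple x y (B p w)

/-- The existence of a Pfaffian complex whose middle modules have rank `m`. -/
def HasPfaffianComplex {R : Type u} [CommRing R] (x y z : R) (m : ℕ) : Prop :=
  ∃ (U : Type u) (_ : AddCommGroup U) (_ : Module R U) (_ : Module.Free R U)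
    (_ : Module.Finite R U) (B : R × R × U →ₗ[R] R × R × U →ₗ[R] R)
    (A : R × R × U →ₗ[R] R × R × U) (p : R × R × U),
    Module.finrank R U + 2 = m ∧ IsPfaffianComplex x y z B A p

namespace IsPfaffianComplex

variable {R : Type*} [CommRing R] {x y z : R} {U : Type*} [AddCommGroup U] [Module R U]
  {B : R × R × U →ₗ[R] R × R × U →ₗ[R] R} {A : R × R × U →ₗ[R] R × R × U} {p : R × R × U}

lemma skew (H : IsPfaffianComplex x y z B A p) (s t : R × R × U) : B s (A t) = -B t (A s) := by
  have h := H.alternating (s + t)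
  simp only [map_add, LinearMap.add_apply, H.alternating, zero_add, add_zero] at h
  exact eq_neg_of_add_eq_zero_right h

lemma form_map (H : IsPfaffianComplex x y z B A p) (t : R × R × U) : B p (A t) = 0 := by
  rw [H.skew, H.map_eq_zero, map_zero, neg_zero]

lemma form_mem (H : IsPfaffianComplex x y z B A p) (v : R × R × U) :
    B p v ∈ Ideal.span {x, y, z} :=
  mem_smul_top_self_iff.1 (map_mem_smul_top (B.flip v) H.minimal_vec)

/-- Pairs of vectors give rise to second order Pfaffians. -/
lemma exists_map_eq (H : IsPfaffianComplex x y z B A p) (r s : R × R × U) :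
    ∃ q, A q = B p r • s - B p s • r :=
  H.exists_map _ (by simp [mul_comm])

end IsPfaffianComplex

/-- The orthogonal sum of a bilinear form with the standard form of rank two. -/
def extendForm {R V : Type*} [CommRing R] [AddCommGroup V] [Module R V] (B : V →ₗ[R] V →ₗ[R] R) :
    R × R × V →ₗ[R] R × R × V →ₗ[R] R :=
  LinearMap.mk₂ R (fun v w => v.1 * w.1 + v.2.1 * w.2.1 + B v.2.2 w.2.2)
    (by intros; simp; ring) (by intros; simp; ring) (by intros; simp; ring) (by intros; simp; ring)

@[simp]
lemma extendForm_apply {R V : Type*} [CommRing R] [AddCommGroup V] [Module R V]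
    (B : V →ₗ[R] V →ₗ[R] R) (v w : R × R × V) :
    extendForm B v w = v.1 * w.1 + v.2.1 * w.2.1 + B v.2.2 w.2.2 := rfl

/-- The cross product with `(x, y, z)`. -/
def koszulMap {R : Type*} [CommRing R] (x y z : R) : R × R × R →ₗ[R] R × R × R where
  toFun v := (y * v.2.2 - z * v.2.1, z * v.1 - x * v.2.2, x * v.2.1 - y * v.1)
  map_add' v w := by ext <;> simp <;> ring
  map_smul' c v := by ext <;> simp <;> ring

lemma isPfaffianComplex_koszulMap {R : Type*} [CommRing R] {x y z : R} (h : RegTriple x y z) :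
    IsPfaffianComplex x y z (extendForm (LinearMap.mul R R)) (koszulMap x y z) (x, y, z) where
  form_fst t := by simp
  form_snd t := by simp
  alternating t := by simp [koszulMap]; ring
  map_eq_zero := by ext <;> simp [koszulMap] <;> ring
  exists_smul := by
    rintro ⟨a, b, c⟩ ht
    obtain ⟨h1, h2, h3⟩ : y * c - z * b = 0 ∧ z * a - x * c = 0 ∧ x * b - y * a = 0 := by
      simpa [koszulMap] using ht
    obtain ⟨t, rfl, rfl, rfl⟩ := h.koszul_two a b c (sub_eq_zero.1 h2) (sub_eq_zero.1 h3)
    exact ⟨t, by simp [mul_comm]⟩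
  exists_map := by
    rintro ⟨a, b, c⟩ ht
    obtain ⟨p, q, r, rfl, rfl, rfl⟩ := h.koszul_one a b c (by simpa using ht)
    exact ⟨(p, q, r), rfl⟩
  minimal_map v := by
    simp only [koszulMap, LinearMap.coe_mk, AddHom.coe_mk, mk_mem_smul_top_iff,
      mem_smul_top_self_iff]
    refine ⟨sub_mem ?_ ?_, sub_mem ?_ ?_, sub_mem ?_ ?_⟩ <;>
      exact Ideal.mul_mem_right _ _ (Ideal.subset_span (by simp))
  minimal_vec := by
    simp only [mk_mem_smul_top_iff, mem_smul_top_self_iff]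
    refine ⟨?_, ?_, ?_⟩ <;> exact Ideal.subset_span (by simp)
  pow_fst := ⟨1, by simp⟩
  pow_snd := ⟨1, by simp⟩
  regular := ⟨(0, 0, 1), by simpa using h⟩

namespace HasPfaffianComplex

variable {R : Type u} [CommRing R] {x y z : R} {n : ℕ}

lemma three [Nontrivial R] (h : RegTriple x y z) : HasPfaffianComplex x y z 3 :=
  ⟨R, inferInstance, inferInstance, inferInstance, inferInstance, _, _, _, by simp,
    isPfaffianComplex_koszulMap h⟩

/-- The alternating matrix is bordered by two rows and columns with entries from `x, y, z`. The new
Pfaffian vector is `(x * p.1, y * p.2.1, z • p + (x * y) • q)`, where `q` consists of second order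
Pfaffians. -/
lemma add_two [Nontrivial R] (h : RegTriple x y z) (H : HasPfaffianComplex x y z n) :
    HasPfaffianComplex x y z (n + 2) := by
  obtain ⟨U, _, _, _, _, B, A, p, hU, H⟩ := H
  have hx : x ∈ Ideal.span {x, y, z} := HasAdaptedResolution.x_mem
  have hy : y ∈ Ideal.span {x, y, z} := HasAdaptedResolution.y_mem
  have hz : z ∈ Ideal.span {x, y, z} := HasAdaptedResolution.z_mem
  obtain ⟨m, hm⟩ := H.pow_fst
  obtain ⟨m', hm'⟩ := H.pow_snd
  obtain ⟨w, hw⟩ := H.regular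
  set e₁ : R × R × U := (1, 0, 0) with he₁
  set e₂ : R × R × U := (0, 1, 0) with he₂
  have hB₁ : ∀ t, B t e₁ = t.1 := H.form_fst
  have hB₂ : ∀ t, B t e₂ = t.2.1 := H.form_snd
  obtain ⟨q, hq, hq₁, hq₂⟩ : ∃ q, A q = p.1 • e₂ - p.2.1 • e₁ ∧ q.1 = 0 ∧ q.2.1 = 0 := by
    obtain ⟨q, hq⟩ := H.exists_map_eq e₁ e₂
    rw [hB₁, hB₂] at hq
    have hqq := H.alternating q
    -- As `A` is alternating, the first two coordinates of `q` are proportional to those of `p`;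
    -- subtracting a multiple of `p` makes them vanish without changing `A q`.
    rw [hq, map_sub, map_smul, map_smul, hB₁, hB₂, smul_eq_mul, smul_eq_mul] at hqq
    have hreg := h.pow_pow m m'
    rw [← hm, ← hm'] at hreg
    obtain ⟨c, hc⟩ := hreg.snd q.1 q.2.1 (by linear_combination -hqq)
    have hc' : q.2.1 = p.2.1 * c := sub_eq_zero.1 (hreg.fst _ (by
      linear_combination hqq + p.2.1 * hc))
    exact ⟨q - c • p, by rw [map_sub, map_smul, H.map_eq_zero, hq]; simp,
      by simp [hc, mul_comm], by simp [hc', mul_comm]⟩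
  have hregz := h.pow_pow (m + 1) (m' + 1)
  have hregw : RegTriple x y (z * B p w + x * y * B q w) := (h.mul_trd hw).add_trd _
  have hregw' := hregw.pow_pow (m + 1) (m' + 1)
  rw [pow_succ', pow_succ', ← hm, ← hm'] at hregz hregw'
  let A' : R × R × R × R × U →ₗ[R] R × R × R × R × U :=
    { toFun := fun v => (y * v.2.2.2.1 - z * v.2.1, z * v.1 - x * v.2.2.1,
        A v.2.2 - (v.1 * y) • e₂ + (v.2.1 * x) • e₁)
      map_add' := by
        intro v w
        refine Prod.ext ?_ (Prod.ext ?_ ?_)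
        · simp; ring
        · simp; ring
        · simp only [Prod.fst_add, Prod.snd_add, map_add]; module
      map_smul' := by
        intro c v
        refine Prod.ext ?_ (Prod.ext ?_ ?_)
        · simp; ring
        · simp; ring
        · simp only [Prod.smul_fst, Prod.smul_snd, map_smul, RingHom.id_apply, smul_eq_mul]
          module }
  have hA' : ∀ a b t, A' (a, b, t) = (y * t.2.1 - z * b, z * a - x * t.1,
    A t - (a * y) • e₂ + (b * x) • e₁) := fun a b t => rfl
  refine ⟨R × R × U, inferInstance, inferInstance, inferInstance, inferInstance, extendForm B,
    A', (x * p.1, y * p.2.1, z • p + (x * y) • q), by simp; omega, ?_⟩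
  have hform : ∀ a b v, extendForm B (x * p.1, y * p.2.1, z • p + (x * y) • q) (a, b, v) =
      x * p.1 * a + y * p.2.1 * b + z * B p v + x * y * B q v := by
    intro a b v
    simp; ring
  constructor
  · intro t; simp
  · intro t; simp
  · rintro ⟨a, b, t⟩
    simp only [hA', extendForm_apply, map_add, map_sub, map_smul, H.alternating, hB₁, hB₂,
      smul_eq_mul]
    ring
  · rw [hA']
    refine Prod.ext ?_ (Prod.ext ?_ ?_)
    · simp [hq₂]; ring
    · simp [hq₁]; ring
    · simp only [map_add, map_smul, H.map_eq_zero, hq, Prod.snd_zero]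
      module
  · rintro ⟨a, b, t⟩ ht
    rw [hA'] at ht
    simp only [Prod.mk_eq_zero] at ht
    obtain ⟨h1, h2, h3⟩ := ht
    -- Pairing with `p` kills the image of `A` and leaves a Koszul relation for `a` and `b`.
    have h4 := congrArg (B p) h3
    simp only [map_add, map_sub, H.form_map, map_smul, hB₁, hB₂, smul_eq_mul, map_zero] at h4
    obtain ⟨c, rfl⟩ := hregz.snd a b (by linear_combination -h4)
    have hb : b = y * p.2.1 * c := sub_eq_zero.1 (hregz.fst _ (by linear_combination h4))
    obtain ⟨d, hd⟩ := H.exists_smul (t - (c * x * y) • q) (by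
      rw [map_sub, map_smul, hq, ← h3, hb]; module)
    have hd' : d = z * c := by
      have := congrArg Prod.fst hd
      simp only [Prod.fst_sub, Prod.smul_fst, hq₁, smul_eq_mul, mul_zero, sub_zero] at this
      exact (sub_eq_zero.1 (hregz.fst _ (by linear_combination h2 + x * this))).symm
    refine ⟨c, ?_⟩
    rw [sub_eq_iff_eq_add.1 hd, hd', hb]
    refine Prod.ext ?_ (Prod.ext ?_ ?_)
    · simp [mul_comm]
    · simp [mul_comm]
    · simp only [Prod.smul_snd]; module
  · rintro ⟨a, b, v⟩ hv
    rw [hform] at hv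
    -- multiplication by `z + q / p` is injective modulo `f, g`
    obtain ⟨τ, hτ⟩ := H.exists_map_eq w v
    have h1 := H.skew q τ
    rw [hτ, hq] at h1
    simp only [map_sub, map_smul, hB₁, hB₂, smul_eq_mul] at h1
    -- By the Plücker-type relation `h1`, `B p w` times `hv` puts `(z * B p w + x * y * B q w) * B p
    -- v` into `(x * p.1, y * p.2.1)`; the first factor is regular modulo this ideal.
    obtain ⟨t₁, t₂, ht⟩ := hregw'.trd (B p v) (-(B p w) * a + y * τ.2.1)
      (-(B p w) * b - x * τ.1) (by
        linear_combination B p w * hv - x * y * h1)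
    obtain ⟨t, ht'⟩ := H.exists_map (v - (t₁ * x) • e₁ - (t₂ * y) • e₂) (by
      simp only [map_sub, map_smul, hB₁, hB₂, smul_eq_mul, ht]; ring)
    have hv' : v = A t + (t₁ * x) • e₁ + (t₂ * y) • e₂ := by rw [ht']; module
    have h2 : B q v = p.2.1 * t.1 - p.1 * t.2.1 := by
      rw [hv', map_add, map_add, map_smul, map_smul, hB₁, hB₂, hq₁, hq₂, H.skew, hq]
      simp [hB₁, hB₂]
    rw [h2, ht] at hv
    obtain ⟨c, hc⟩ := hregz.snd (b + z * t₂ + x * t.1) (-(a + z * t₁ - y * t.2.1)) (by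
      linear_combination hv)
    have hc' : a + z * t₁ - y * t.2.1 = - (y * p.2.1 * c) := by
      rw [← sub_eq_zero]
      exact hregz.fst _ (by linear_combination hv - y * p.2.1 * hc)
    refine ⟨(-t₂, t₁, t - c • p), ?_⟩
    rw [hA']
    refine Prod.ext ?_ (Prod.ext ?_ ?_)
    · simp; linear_combination -hc'
    · simp; linear_combination -hc
    · simp only [map_sub, map_smul, H.map_eq_zero, ht']; module
  · rintro ⟨a, b, t⟩
    rw [hA']
    refine mk_mem_smul_top_iff.2 ⟨mem_smul_top_self_iff.2 (sub_mem ?_ ?_), mk_mem_smul_top_iff.2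
      ⟨mem_smul_top_self_iff.2 (sub_mem ?_ ?_), add_mem (sub_mem (H.minimal_map t) ?_) ?_⟩⟩
    any_goals exact Ideal.mul_mem_right _ _ (by assumption)
    all_goals exact smul_mem_smul_top (Ideal.mul_mem_left _ _ (by assumption)) _
  · exact mk_mem_smul_top_iff.2 ⟨mem_smul_top_self_iff.2 (Ideal.mul_mem_right _ _ hx),
      mk_mem_smul_top_iff.2 ⟨mem_smul_top_self_iff.2 (Ideal.mul_mem_right _ _ hy),
      add_mem (smul_mem_smul_top hz _) (smul_mem_smul_top (Ideal.mul_mem_right _ _ hx) _)⟩⟩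
  · exact ⟨m + 1, by simp [hm, pow_succ']⟩
  · exact ⟨m' + 1, by simp [hm', pow_succ']⟩
  · refine ⟨(0, 0, w), ?_⟩
    rw [hform]
    simpa using hregw

lemma odd [Nontrivial R] (h : RegTriple x y z) (k : ℕ) : HasPfaffianComplex x y z (2 * k + 3) := by
  induction k with
  | zero => exact three h
  | succ k ih => exact add_two h ih

lemma hasAdaptedResolution_one [Nontrivial R] (h : RegTriple x y z)
    (H : HasPfaffianComplex x y z (n + 1)) : HasAdaptedResolution x y z 1 n := by
  obtain ⟨U, _, _, _, _, B, A, p, hU, H⟩ := H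
  obtain ⟨m, hm⟩ := H.pow_fst
  refine ⟨R, R × R × U, U, inferInstance, inferInstance, inferInstance, inferInstance,
    inferInstance, inferInstance, inferInstance, inferInstance, inferInstance, inferInstance,
    inferInstance, inferInstance, LinearMap.toSpanSingleton R _ p, A, B p, by simp,
    by simp; omega, by omega, ?_⟩
  constructor
  · intro c hc
    have := (h.pow_pow m 0).fst c (by simpa [hm, mul_comm] using congrArg Prod.fst hc)
    exact this
  · intro t; simp [H.map_eq_zero]
  · intro v hv
    obtain ⟨c, rfl⟩ := H.exists_smul v hv
    exact ⟨c, rfl⟩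
  · exact H.form_map
  · exact H.exists_map
  · intro t
    exact Submodule.smul_mem _ _ H.minimal_vec
  · exact H.minimal_map
  · exact H.form_mem
  · exact ⟨m, by rw [H.form_fst, hm]⟩
  · obtain ⟨m', hm'⟩ := H.pow_snd
    exact ⟨m', by rw [H.form_snd, hm']⟩
  · exact H.regular

end HasPfaffianComplex

/-! ### Links of Pfaffian ideals -/

/-- The data of a link of the ideal resolved by a Pfaffian complex: three vectors `r₁, r₂, r₃`,
second order Pfaffians `q₁, q₂, q₃` and the third order Pfaffian `δ`. -/
structure IsPfaffianLink {R V : Type*} [CommRing R] [AddCommGroup V] [Module R V]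
    (B : V →ₗ[R] V →ₗ[R] R) (A : V →ₗ[R] V) (p r₁ r₂ r₃ q₁ q₂ q₃ : V) (δ : R) : Prop where
  map_fst : A q₁ = B p r₂ • r₃ - B p r₃ • r₂
  map_snd : A q₂ = B p r₃ • r₁ - B p r₁ • r₃
  map_trd : A q₃ = B p r₁ • r₂ - B p r₂ • r₁
  sum_eq : B p r₁ • q₁ + B p r₂ • q₂ + B p r₃ • q₃ = δ • p

namespace IsPfaffianLink

section

variable {R V : Type*} [CommRing R] [AddCommGroup V] [Module R V] {B : V →ₗ[R] V →ₗ[R] R}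
  {A : V →ₗ[R] V} {p r₁ r₂ r₃ q₁ q₂ q₃ : V} {δ : R}

/-- Rescaling the `rᵢ` multiplies the `qᵢ` and `δ` by products of the scalars; this is what makes
the resolution of the link minimal. -/
lemma smul (L : IsPfaffianLink B A p r₁ r₂ r₃ q₁ q₂ q₃ δ) (a b c : R) :
    IsPfaffianLink B A p (a • r₁) (b • r₂) (c • r₃) ((b * c) • q₁) ((c * a) • q₂) ((a * b) • q₃)
      (a * b * c * δ) where
  map_fst := by simp only [map_smul, L.map_fst, smul_eq_mul]; module
  map_snd := by simp only [map_smul, L.map_snd, smul_eq_mul]; module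
  map_trd := by simp only [map_smul, L.map_trd, smul_eq_mul]; module
  sum_eq := by
    rw [mul_smul (a * b * c) δ p, ← L.sum_eq]
    simp only [map_smul, smul_eq_mul]
    module

/-- The last differential of the resolution of the link. -/
def d₃ (B : V →ₗ[R] V →ₗ[R] R) (A : V →ₗ[R] V) (r₁ r₂ r₃ : V) : V →ₗ[R] V × R × R × R :=
  A.prod ((B.flip r₁).prod ((B.flip r₂).prod (B.flip r₃)))

@[simp]
lemma d₃_apply (t : V) : d₃ B A r₁ r₂ r₃ t = (A t, B t r₁, B t r₂, B t r₃) := rfl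

/-- The middle differential of the resolution of the link. -/
def d₂ (B : V →ₗ[R] V →ₗ[R] R) (p r₁ r₂ r₃ q₁ q₂ q₃ : V) : V × R × R × R →ₗ[R] R × R × R × R where
  toFun v := (B q₁ v.1 + B p r₂ * v.2.2.2 - B p r₃ * v.2.2.1,
    B q₂ v.1 + B p r₃ * v.2.1 - B p r₁ * v.2.2.2,
    B q₃ v.1 + B p r₁ * v.2.2.1 - B p r₂ * v.2.1, B p v.1)
  map_add' v w := by ext <;> simp <;> ring
  map_smul' c v := by ext <;> simp <;> ring

lemma d₂_apply (v : V) (a b c : R) : d₂ B p r₁ r₂ r₃ q₁ q₂ q₃ (v, a, b, c) =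
    (B q₁ v + B p r₂ * c - B p r₃ * b, B q₂ v + B p r₃ * a - B p r₁ * c,
    B q₃ v + B p r₁ * b - B p r₂ * a, B p v) := rfl

/-- The first differential of the resolution of the link. -/
def d₁ (B : V →ₗ[R] V →ₗ[R] R) (p r₁ r₂ r₃ : V) (δ : R) : R × R × R × R →ₗ[R] R where
  toFun v := B p r₁ * v.1 + B p r₂ * v.2.1 + B p r₃ * v.2.2.1 - δ * v.2.2.2
  map_add' v w := by simp; ring
  map_smul' c v := by simp; ring

lemma d₁_apply (a b c s : R) : d₁ B p r₁ r₂ r₃ δ (a, b, c, s) =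
    B p r₁ * a + B p r₂ * b + B p r₃ * c - δ * s := rfl

lemma sum_form (L : IsPfaffianLink B A p r₁ r₂ r₃ q₁ q₂ q₃ δ) (v : V) :
    B p r₁ * B q₁ v + B p r₂ * B q₂ v + B p r₃ * B q₃ v = δ * B p v := by
  have := congrArg (fun t => B t v) L.sum_eq
  simpa using this

lemma d₁_comp_d₂ (L : IsPfaffianLink B A p r₁ r₂ r₃ q₁ q₂ q₃ δ) (v : V × R × R × R) :
    d₁ B p r₁ r₂ r₃ δ (d₂ B p r₁ r₂ r₃ q₁ q₂ q₃ v) = 0 := by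
  obtain ⟨v, a, b, c⟩ := v
  rw [d₂_apply, d₁_apply]
  linear_combination L.sum_form v

lemma d₂_mem {I : Ideal R} (h₁ : B p r₁ ∈ I) (h₂ : B p r₂ ∈ I) (h₃ : B p r₃ ∈ I)
    (hp : ∀ v, B p v ∈ I) (hq₁ : ∀ v, B q₁ v ∈ I) (hq₂ : ∀ v, B q₂ v ∈ I) (hq₃ : ∀ v, B q₃ v ∈ I)
    (v : V × R × R × R) :
    d₂ B p r₁ r₂ r₃ q₁ q₂ q₃ v ∈ I • (⊤ : Submodule R (R × R × R × R)) := by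
  simp only [d₂, LinearMap.coe_mk, AddHom.coe_mk, mk_mem_smul_top_iff, mem_smul_top_self_iff]
  exact ⟨sub_mem (add_mem (hq₁ _) (Ideal.mul_mem_right _ _ h₂)) (Ideal.mul_mem_right _ _ h₃),
    sub_mem (add_mem (hq₂ _) (Ideal.mul_mem_right _ _ h₃)) (Ideal.mul_mem_right _ _ h₁),
    sub_mem (add_mem (hq₃ _) (Ideal.mul_mem_right _ _ h₁)) (Ideal.mul_mem_right _ _ h₂), hp _⟩

lemma d₁_mem {I : Ideal R} (h₁ : B p r₁ ∈ I) (h₂ : B p r₂ ∈ I) (h₃ : B p r₃ ∈ I) (hδ : δ ∈ I)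
    (v : R × R × R × R) : d₁ B p r₁ r₂ r₃ δ v ∈ I :=
  sub_mem (add_mem (add_mem (Ideal.mul_mem_right _ _ h₁) (Ideal.mul_mem_right _ _ h₂))
    (Ideal.mul_mem_right _ _ h₃)) (Ideal.mul_mem_right _ _ hδ)

end

variable {R : Type*} [CommRing R] {x y z : R} {U : Type*} [AddCommGroup U] [Module R U]
  {B : R × R × U →ₗ[R] R × R × U →ₗ[R] R} {A : R × R × U →ₗ[R] R × R × U}
  {p r₁ r₂ r₃ q₁ q₂ q₃ : R × R × U} {δ : R}

/-- The combination of the `qᵢ` with coefficients `B p rᵢ` is killed by `A`, hence is a multiple of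
`p`; the factor is `δ`. -/
lemma _root_.IsPfaffianComplex.exists_link (H : IsPfaffianComplex x y z B A p)
    (r₁ r₂ r₃ : R × R × U) : ∃ q₁ q₂ q₃ δ, IsPfaffianLink B A p r₁ r₂ r₃ q₁ q₂ q₃ δ := by
  obtain ⟨q₁, h₁⟩ := H.exists_map_eq r₂ r₃
  obtain ⟨q₂, h₂⟩ := H.exists_map_eq r₃ r₁
  obtain ⟨q₃, h₃⟩ := H.exists_map_eq r₁ r₂
  obtain ⟨δ, hδ⟩ := H.exists_smul (B p r₁ • q₁ + B p r₂ • q₂ + B p r₃ • q₃) (by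
    simp only [map_add, map_smul, h₁, h₂, h₃]; module)
  exact ⟨q₁, q₂, q₃, δ, h₁, h₂, h₃, hδ⟩

lemma d₂_comp_d₃ (H : IsPfaffianComplex x y z B A p)
    (L : IsPfaffianLink B A p r₁ r₂ r₃ q₁ q₂ q₃ δ) (t : R × R × U) :
    d₂ B p r₁ r₂ r₃ q₁ q₂ q₃ (d₃ B A r₁ r₂ r₃ t) = 0 := by
  rw [d₃_apply, d₂_apply, H.skew q₁, H.skew q₂, H.skew q₃, L.map_fst, L.map_snd, L.map_trd,
    H.form_map]
  simp

lemma d₃_injective (H : IsPfaffianComplex x y z B A p)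
    (h : RegTriple (B p r₁) (B p r₂) (B p r₃)) (t : R × R × U) (ht : d₃ B A r₁ r₂ r₃ t = 0) :
    t = 0 := by
  simp only [d₃_apply, Prod.mk_eq_zero] at ht
  obtain ⟨c, rfl⟩ := H.exists_smul t ht.1
  rw [h.fst c (by simpa [mul_comm] using ht.2.1), zero_smul]

lemma exists_d₃_eq (H : IsPfaffianComplex x y z B A p)
    (L : IsPfaffianLink B A p r₁ r₂ r₃ q₁ q₂ q₃ δ) (h : RegTriple (B p r₁) (B p r₂) (B p r₃))
    (v : (R × R × U) × R × R × R) (hv : d₂ B p r₁ r₂ r₃ q₁ q₂ q₃ v = 0) :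
    ∃ t, d₃ B A r₁ r₂ r₃ t = v := by
  obtain ⟨v, a, b, c⟩ := v
  simp only [d₂_apply, Prod.mk_eq_zero] at hv
  obtain ⟨h1, h2, h3, h4⟩ := hv
  obtain ⟨t, rfl⟩ := H.exists_map v h4
  -- Skew symmetry moves `A` onto the `qᵢ`, so that the differences `a - B t r₁`, `b - B t r₂`, `c -
  -- B t r₃` form a Koszul cycle. It is absorbed by adding a multiple of `p` to `t`.
  rw [H.skew, L.map_snd] at h2
  rw [H.skew, L.map_trd] at h3
  simp only [map_sub, map_smul, smul_eq_mul] at h2 h3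
  obtain ⟨s, hs₁, hs₂, hs₃⟩ := h.koszul_two (a - B t r₁) (b - B t r₂) (c - B t r₃)
    (by simp only [smul_eq_mul]; linear_combination h2)
    (by simp only [smul_eq_mul]; linear_combination h3)
  refine ⟨t + s • p, ?_⟩
  simp only [smul_eq_mul] at hs₁ hs₂ hs₃
  rw [d₃_apply]
  simp only [(A).map_add, (A).map_smul, H.map_eq_zero, B.map_add, B.map_smul, LinearMap.add_apply,
    LinearMap.smul_apply, smul_eq_mul, smul_zero, add_zero]
  refine Prod.ext rfl (Prod.ext ?_ (Prod.ext ?_ ?_))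
  · linear_combination -hs₁
  · linear_combination -hs₂
  · linear_combination -hs₃

/-- This is the linkage statement that the colon of `(B p r₁, B p r₂, B p r₃)` by `δ` lies in the
Pfaffian ideal. Koszul exactness with coefficients in the free module is used twice: applying `A` to
a first-degree boundary produces a second-degree cycle, and pairing the result with `p` exhibits
`s`. -/
lemma exists_form_eq [Module.Free R U] [Module.Finite R U] (H : IsPfaffianComplex x y z B A p)
    (L : IsPfaffianLink B A p r₁ r₂ r₃ q₁ q₂ q₃ δ) (h : RegTriple (B p r₁) (B p r₂) (B p r₃))
    (a b c s : R) (hs : B p r₁ * a + B p r₂ * b + B p r₃ * c = δ * s) : ∃ v, B p v = s := by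
  obtain ⟨k₁, k₂, k₃, h1, h2, h3⟩ := h.koszul_one (a • p - s • q₁) (b • p - s • q₂)
    (c • p - s • q₃) (by
      calc _ = (B p r₁ * a + B p r₂ * b + B p r₃ * c) • p -
            s • (B p r₁ • q₁ + B p r₂ • q₂ + B p r₃ • q₃) := by module
        _ = 0 := by rw [hs, L.sum_eq]; module)
  replace h2 := congrArg A h2
  replace h3 := congrArg A h3
  simp only [map_sub, map_smul, H.map_eq_zero, L.map_snd, L.map_trd] at h2 h3
  obtain ⟨t, ht, -, -⟩ := h.koszul_two (A k₁ + s • r₁) (A k₂ + s • r₂) (A k₃ + s • r₃)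
    (by rw [← sub_eq_zero] at h2 ⊢; rw [← neg_eq_zero, ← h2]; module)
    (by rw [← sub_eq_zero] at h3 ⊢; rw [← neg_eq_zero, ← h3]; module)
  replace ht := congrArg (B p) ht
  simp only [map_add, H.form_map, map_smul, smul_eq_mul, zero_add] at ht
  exact ⟨t, (sub_eq_zero.1 (h.fst _ (by linear_combination ht))).symm⟩

lemma exists_d₂_eq [Module.Free R U] [Module.Finite R U] (H : IsPfaffianComplex x y z B A p)
    (L : IsPfaffianLink B A p r₁ r₂ r₃ q₁ q₂ q₃ δ) (h : RegTriple (B p r₁) (B p r₂) (B p r₃))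
    (w : R × R × R × R) (hw : d₁ B p r₁ r₂ r₃ δ w = 0) :
    ∃ v, d₂ B p r₁ r₂ r₃ q₁ q₂ q₃ v = w := by
  obtain ⟨a, b, c, s⟩ := w
  rw [d₁_apply] at hw
  obtain ⟨v, rfl⟩ := exists_form_eq H L h a b c s (sub_eq_zero.1 hw)
  obtain ⟨k₁, k₂, k₃, h1, h2, h3⟩ := h.koszul_one (a - B q₁ v) (b - B q₂ v) (c - B q₃ v) (by
    simp only [smul_eq_mul]
    linear_combination hw - L.sum_form v)
  refine ⟨(v, k₁, k₂, k₃), ?_⟩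
  simp only [smul_eq_mul] at h1 h2 h3
  rw [d₂_apply]
  refine Prod.ext ?_ (Prod.ext ?_ (Prod.ext ?_ rfl))
  · linear_combination -h1
  · linear_combination -h2
  · linear_combination -h3

end IsPfaffianLink

/-! ### Formats with `l = 3` -/

namespace HasPfaffianComplex

open IsPfaffianLink

variable {R : Type u} [CommRing R] {x y z : R} {n : ℕ}

lemma hasAdaptedResolution_three [Nontrivial R] (h : RegTriple x y z)
    (H : HasPfaffianComplex x y z n) : HasAdaptedResolution x y z n 3 := by
  obtain ⟨U, _, _, _, _, B, A, p, hU, H⟩ := H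
  have hx : x ∈ Ideal.span {x, y, z} := HasAdaptedResolution.x_mem
  have hy : y ∈ Ideal.span {x, y, z} := HasAdaptedResolution.y_mem
  have hz : z ∈ Ideal.span {x, y, z} := HasAdaptedResolution.z_mem
  obtain ⟨m, hm⟩ := H.pow_fst
  obtain ⟨m', hm'⟩ := H.pow_snd
  obtain ⟨w, hw⟩ := H.regular
  obtain ⟨q₁, q₂, q₃, δ, L⟩ := H.exists_link (1, 0, 0) (0, 1, 0) w
  replace L := L.smul x y z
  have hreg := (h.mul_trd hw).pow_pow (m + 1) (m' + 1)
  have h₁ : B p (x • (1, 0, 0)) = x ^ (m + 1) := by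
    rw [map_smul, H.form_fst, hm, smul_eq_mul, pow_succ']
  have h₂ : B p (y • (0, 1, 0)) = y ^ (m' + 1) := by
    rw [map_smul, H.form_snd, hm', smul_eq_mul, pow_succ']
  have h₃ : B p (z • w) = z * B p w := by rw [map_smul, smul_eq_mul]
  rw [← h₁, ← h₂, ← h₃] at hreg
  have hsmul : ∀ {a : R} (v t : R × R × U), a ∈ Ideal.span {x, y, z} →
      B (a • v) t ∈ Ideal.span {x, y, z} := fun v t ha => by
    rw [map_smul]; exact Ideal.mul_mem_right _ _ ha
  refine ⟨R × R × U, (R × R × U) × R × R × R, R × R, inferInstance, inferInstance, inferInstance,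
    inferInstance, inferInstance, inferInstance, inferInstance, inferInstance, inferInstance,
    inferInstance, inferInstance, inferInstance, _, _, _, by simp; omega, by simp; omega, by simp,
    d₃_injective H hreg, d₂_comp_d₃ H L, exists_d₃_eq H L hreg, L.d₁_comp_d₂,
    exists_d₂_eq H L hreg, fun t => ?_,
    d₂_mem (H.form_mem _) (H.form_mem _) (H.form_mem _) H.form_mem
      (fun v => hsmul _ _ (Ideal.mul_mem_right _ _ hy))
      (fun v => hsmul _ _ (Ideal.mul_mem_right _ _ hz))
      (fun v => hsmul _ _ (Ideal.mul_mem_right _ _ hx)),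
    d₁_mem (H.form_mem _) (H.form_mem _) (H.form_mem _)
      (Ideal.mul_mem_right _ _ (Ideal.mul_mem_left _ _ hz)),
    ⟨m + 1, ?_⟩, ⟨m' + 1, ?_⟩, ⟨(0, 0, 1, 0), ?_⟩⟩
  · rw [d₃_apply]
    refine mk_mem_smul_top_iff.2 ⟨H.minimal_map t, ?_⟩
    simp only [mk_mem_smul_top_iff, map_smul]
    exact ⟨smul_mem_smul_top hx _, smul_mem_smul_top hy _, smul_mem_smul_top hz _⟩
  · rw [d₁_apply, h₁]; simp
  · rw [d₁_apply, h₂]; simp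
  · rw [d₁_apply, h₃]; simpa using h.mul_trd hw

/-- Leaving `r₁ = (1, 0, 0)` unscaled gives the last differential of the link a unit entry, because
`B t r₁ = t.1`. Splitting off this trivial summand lowers both ranks by one; the factors `y` and `z`
alone keep the remaining maps minimal. -/
lemma hasAdaptedResolution_pred_three [Nontrivial R] (h : RegTriple x y z)
    (H : HasPfaffianComplex x y z (n + 1)) : HasAdaptedResolution x y z n 3 := by
  obtain ⟨U, _, _, _, _, B, A, p, hU, H⟩ := H
  have hx : x ∈ Ideal.span {x, y, z} := HasAdaptedResolution.x_mem
  have hy : y ∈ Ideal.span {x, y, z} := HasAdaptedResolution.y_mem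
  have hz : z ∈ Ideal.span {x, y, z} := HasAdaptedResolution.z_mem
  obtain ⟨m, hm⟩ := H.pow_fst
  obtain ⟨m', hm'⟩ := H.pow_snd
  obtain ⟨w, hw⟩ := H.regular
  obtain ⟨q₁, q₂, q₃, δ, L⟩ := H.exists_link (1, 0, 0) (0, 1, 0) w
  replace L := L.smul 1 y z
  rw [one_smul] at L
  have hreg := (h.mul_trd hw).pow_pow m (m' + 1)
  have h₁ : B p (1, 0, 0) = x ^ m := by rw [H.form_fst, hm]
  have h₂ : B p (y • (0, 1, 0)) = y ^ (m' + 1) := by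
    rw [map_smul, H.form_snd, hm', smul_eq_mul, pow_succ']
  have h₃ : B p (z • w) = z * B p w := by rw [map_smul, smul_eq_mul]
  rw [← h₁, ← h₂, ← h₃] at hreg
  have hsmul : ∀ {a : R} (v t : R × R × U), a ∈ Ideal.span {x, y, z} →
      B (a • v) t ∈ Ideal.span {x, y, z} := fun v t ha => by
    rw [map_smul]; exact Ideal.mul_mem_right _ _ ha
  let i₃ : R × U →ₗ[R] R × R × U := LinearMap.inr R R (R × U)
  let i₂ : (R × R × U) × R × R →ₗ[R] (R × R × U) × R × R × R :=
    LinearMap.prodMap LinearMap.id (LinearMap.inr R R (R × R))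
  let π₂ : (R × R × U) × R × R × R →ₗ[R] (R × R × U) × R × R :=
    LinearMap.prodMap LinearMap.id (LinearMap.snd R R (R × R))
  have hi : ∀ t, i₂ (π₂ (d₃ B A (1, 0, 0) (y • (0, 1, 0)) (z • w) (i₃ t))) =
      d₃ B A (1, 0, 0) (y • (0, 1, 0)) (z • w) (i₃ t) := by
    intro t
    simp [i₂, π₂, i₃, H.form_fst]
  have hi₂ : Function.Injective i₂ := fun v w hvw => by
    simpa [i₂, Prod.ext_iff] using hvw
  refine ⟨R × U, (R × R × U) × R × R, R × R, inferInstance, inferInstance, inferInstance,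
    inferInstance, inferInstance, inferInstance, inferInstance, inferInstance, inferInstance,
    inferInstance, inferInstance, inferInstance,
    π₂ ∘ₗ d₃ B A (1, 0, 0) (y • (0, 1, 0)) (z • w) ∘ₗ i₃,
    d₂ B p (1, 0, 0) (y • (0, 1, 0)) (z • w) ((y * z) • q₁) ((z * 1) • q₂) ((1 * y) • q₃) ∘ₗ i₂,
    d₁ B p (1, 0, 0) (y • (0, 1, 0)) (z • w) (1 * y * z * δ), by simp; omega, by simp; omega,
    by simp, ⟨fun t ht => ?_, fun t => ?_, fun v hv => ?_, fun v => L.d₁_comp_d₂ _, fun v hv => ?_,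
    fun t => ?_, fun v => d₂_mem (H.form_mem _) (H.form_mem _) (H.form_mem _) H.form_mem
      (fun v => hsmul _ _ (Ideal.mul_mem_right _ _ hy))
      (fun v => hsmul _ _ (Ideal.mul_mem_right _ _ hz))
      (fun v => hsmul _ _ (Ideal.mul_mem_left _ _ hy)) _,
    d₁_mem (H.form_mem _) (H.form_mem _) (H.form_mem _)
      (Ideal.mul_mem_right _ _ (Ideal.mul_mem_left _ _ hz)),
    ⟨m, ?_⟩, ⟨m' + 1, ?_⟩, ⟨(0, 0, 1, 0), ?_⟩⟩⟩
  · have := d₃_injective H hreg (i₃ t) (by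
      rw [← hi]; exact (congrArg i₂ ht).trans (map_zero _))
    simpa [i₃] using this
  · have := d₂_comp_d₃ H L (i₃ t)
    rwa [← hi] at this
  · obtain ⟨t, ht⟩ := exists_d₃_eq H L hreg (i₂ v) hv
    have ht₀ : t.1 = 0 := by
      rw [← H.form_fst]; exact congrArg (fun v => v.2.1) ht
    have ht₁ : i₃ t.2 = t := Prod.ext ht₀.symm rfl
    refine ⟨t.2, hi₂ ?_⟩
    rw [LinearMap.comp_apply, LinearMap.comp_apply, hi, ht₁, ht]
  · obtain ⟨v', hv'⟩ := exists_d₂_eq H L hreg v hv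
    -- Subtracting this boundary makes the cancelled coordinate zero, since `d₃` reproduces `v'.2.1`
    -- there.
    set u := v' - d₃ B A (1, 0, 0) (y • (0, 1, 0)) (z • w) (v'.2.1, 0, 0) with hu
    have hu₀ : u.2.1 = 0 := by simp [hu, H.form_fst]
    have hu₁ : i₂ (π₂ u) = u := Prod.ext rfl (Prod.ext hu₀.symm rfl)
    refine ⟨π₂ u, ?_⟩
    rw [LinearMap.comp_apply, hu₁, hu, map_sub, d₂_comp_d₃ H L, hv', sub_zero]
  · refine mk_mem_smul_top_iff.2 ⟨H.minimal_map _, ?_⟩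
    change (B (i₃ t) (y • (0, 1, 0)), B (i₃ t) (z • w)) ∈ _
    simp only [mk_mem_smul_top_iff, map_smul]
    exact ⟨smul_mem_smul_top hy _, smul_mem_smul_top hz _⟩
  · rw [d₁_apply, h₁]; simp
  · rw [d₁_apply, h₂]; simp
  · rw [d₁_apply, h₃]; simpa using h.mul_trd hw

end HasPfaffianComplex

/-! ### Reaching all formats -/

namespace HasAdaptedResolution

variable {R : Type u} [CommRing R] {x y z : R} {n l : ℕ}

lemma add_add [Nontrivial R] (h : RegTriple x y z) (H : HasAdaptedResolution x y z n l) (k : ℕ) :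
    HasAdaptedResolution x y z (n + k) (l + k) := by
  induction k with
  | zero => exact H
  | succ k ih => exact succ_succ h ih

lemma one_of_even [Nontrivial R] (h : RegTriple x y z) (hl : Even l) (hl' : 0 < l) :
    HasAdaptedResolution x y z 1 l := by
  obtain ⟨k, rfl⟩ := hl
  obtain ⟨k, rfl⟩ := Nat.exists_eq_succ_of_ne_zero (show k ≠ 0 by omega)
  refine HasPfaffianComplex.hasAdaptedResolution_one h ?_
  convert HasPfaffianComplex.odd h k using 1
  omega

lemma three_of_two_le [Nontrivial R] (h : RegTriple x y z) (hn : 2 ≤ n) :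
    HasAdaptedResolution x y z n 3 := by
  obtain ⟨k, rfl | rfl⟩ : ∃ k, n = 2 * k + 2 ∨ n = 2 * k + 3 := ⟨(n - 2) / 2, by omega⟩
  · exact HasPfaffianComplex.hasAdaptedResolution_pred_three h (HasPfaffianComplex.odd h k)
  · exact HasPfaffianComplex.hasAdaptedResolution_three h (HasPfaffianComplex.odd h k)

/-- `succ_succ` preserves `l - n`, so each diagonal needs only a starting point: a link with `l = 3`
when `l ≤ n + 1`, and otherwise a Gorenstein format `(1, l')` with `l'` even, followed by one
`succ_add_two` if the parity is wrong. -/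
lemma of_three_le [Nontrivial R] (h : RegTriple x y z) (hl : 3 ≤ l) (hn : 2 ≤ n) :
    HasAdaptedResolution x y z n l := by
  obtain hln | hln := le_or_gt l (n + 1)
  · have := (three_of_two_le h (n := n - (l - 3)) (by omega)).add_add h (l - 3)
    rwa [Nat.sub_add_cancel (by omega), Nat.add_sub_cancel' hl] at this
  -- Here `l = n + d + 2`, so the diagonal meets `n = 1` at `l = d + 3`, which is admissible only
  -- for odd `d`.
  obtain ⟨d, hd⟩ := Nat.exists_eq_add_of_lt hln
  obtain heven | hodd := Nat.even_or_odd d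
  · have := ((one_of_even h (l := d + 2) (by simpa [Nat.even_add] using heven)
      (by omega)).succ_add_two h).add_add h (n - 2)
    convert this using 1 <;> omega
  · have := (one_of_even h (l := d + 3) (by
      rw [Nat.even_add]; simpa [show ¬ Even 3 by decide] using hodd) (by omega)).add_add h (n - 1)
    convert this using 1 <;> omega

end HasAdaptedResolution

theorem theorem12p1 {R : Type*} [CommRing R] [IsNoetherianRing R] [IsLocalRing R]
    (hR : 3 ≤ idealDepth (IsLocalRing.maximalIdeal R)) (n l : ℕ)
    (hnl : (3 ≤ l ∧ 2 ≤ n) ∨ (n = 1 ∧ Even l ∧ 0 < l)) :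
    ∃ (d₃ : (Fin n → R) →ₗ[R] (Fin (n + l) → R))
      (d₂ : (Fin (n + l) → R) →ₗ[R] (Fin (l + 1) → R))
      (d₁ : (Fin (l + 1) → R) →ₗ[R] R) (I : Ideal R),
      IsFreeResolutionOfQuotient d₃ d₂ d₁ I ∧
      IsMinimalMap d₃ ∧ IsMinimalMap d₂ ∧ IsMinimalMap d₁ ∧
      idealDepth I = 3 := by
  obtain ⟨x, hx, y, hy, z, hz, h⟩ := exists_regTriple_of_le_idealDepth hR
  refine HasAdaptedResolution.exists_isFreeResolutionOfQuotient h hx hy hz ?_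
  obtain ⟨hl, hn⟩ | ⟨rfl, hl, hl'⟩ := hnl
  · exact HasAdaptedResolution.of_three_le h hl hn
  · exact HasAdaptedResolution.one_of_even h hl hl'
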